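/- **Setting.** Let $\mathcal X$ be a measurable space, $\mathcal Y\subseteq\mathbb R^d$ compact and convex, $\mathcal D$ a probability distribution on $\mathcal X\times\mathcal Y$, and $\mathcal A$ a finite set of actions. Let $\mathcal H$ be a separable reproducing kernel Hilbert space of real functions on $\mathcal Y$ with kernel $K$ and (measurable) feature map $\phi(y)=K(y,\cdot)$. Let $R_1,R_2\ge 0$ and $\beta>0$, and assume $\|\phi(y)\|_{\mathcal H}\le R_2$ for all $y\in\mathcal Y$. Let $$\mathcal L_{\mathcal H}=\{\ell:\mathcal A\times\mathcal Y\to\mathbb R \mid \ell(a,\cdot)\in\mathcal H,\ \|\ell(a,\cdot)\|_{\mathcal H}\le R_1\ \text{for all } a\in\mathcal A\},\qquad r_\ell(a)=\ell(a,\cdot).$$ Let $p:\mathcal X\to\mathcal H$ be a (measurable) predictor with $\|p(x)\|_{\mathcal H}\le R_2$ for all $x$, let $f_p(x,a,\ell)=\langle r_\ell(a),p(x)\rangle_{\mathcal H}$ be its loss estimator, and let $$\tilde k_{f_p,\ell}(x,a)=\frac{e^{-\beta f_p(x,a,\ell)}}{\sum_{a'\in\mathcal A}e^{-\beta f_p(x,a',\ell)}}$$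 be the smooth optimal decision rule. The decision calibration error is $$\mathrm{decCE}(f_p,\mathcal D)=\sup_{\ell,\ell'\in\mathcal L_{\mathcal H}}\Big|\mathbb E_{(x,y)\sim\mathcal D}\sum_{a}\tilde k_{f_p,\ell'}(x,a)\,\ell(a,y)-\mathbb E_{(x,y)\sim\mathcal D}\sum_{a}\tilde k_{f_p,\ell'}(x,a)\,f_p(x,a,\ell)\Big|.$$ Put $L(\ell,\ell',x,y)=\sum_{a\in\mathcal A}\langle r_\ell(a),\phi(y)-p(x)\rangle_{\mathcal H}\,\tilde k_{f_p,\ell'}(x,a)$. **Theorem.** There are universal constants $C>0$ and $q\in\mathbb N$ such that the following holds in every such setting, for all $\epsilon>0$ and $\delta\in(0,1)$. Let $$M=\frac{|\mathcal A|^2\max(1,\beta R_1R_2)^4R_1^2R_2^2}{\epsilon^2}\qquad\Big(=\frac{|\mathcal A|^2\beta^4R_1^6R_2^6}{\epsilon^2}\ \text{ when } \beta R_1R_2\ge 1\Big),$$ and let $(x_1,y_1),\dots,(x_n,y_n)$ be drawn i.i.d. from $\mathcal D$ with $n\ge C\,M\,\log^q(e+M/\delta)$, that is, $n\ge\tilde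 O(M)$. Then empirical risk minimization, which takes $(p(x_1),y_1),\dots,(p(x_n),y_n)$ and outputs a pair $$(\hat\ell,\hat\ell')\in\arg\max_{\ell,\ell'\in\mathcal L_{\mathcal H}}\ \frac1n\sum_{i=1}^n L(\ell,\ell',x_i,y_i),$$ is an $\epsilon$-auditor: if $\mathrm{decCE}(f_p,\mathcal D)\ge\epsilon$, then with probability at least $1-\delta$ over the sample, a maximizing pair exists and every maximizing pair satisfies $$\Big|\mathbb E_{(x,y)\sim\mathcal D}\big[L(\hat\ell,\hat\ell',x,y)\big]\Big|\ \ge\ \epsilon/2 .$$ -/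

import Mathlib

open MeasureTheory
open scoped RealInnerProductSpace

noncomputable section

namespace DecCal

/-- The feature map `φ(y) = K(y, ·)` of a real reproducing kernel Hilbert space `H` of functions
on `Y`. -/
def feature {Y : Type*} (H : Type*) [NormedAddCommGroup H] [InnerProductSpace ℝ H]
    [CompleteSpace H] [RKHS ℝ H Y ℝ] (y : Y) : H :=
  RKHS.kerFun H y (1 : ℝ)

/-- The class `𝓛_H` of loss functions `ℓ` with `ℓ(a, ·) ∈ H` and `‖ℓ(a, ·)‖ ≤ R₁` for every action
`a`. A loss function is given by its slices `ℓ a = ℓ(a, ·)`, which are elements of the function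
space `H`, so that `ℓ a` is at the same time the coefficient vector `r_ℓ(a)`. -/
def lossClass (A H : Type*) [NormedAddCommGroup H] (R₁ : ℝ) : Set (A → H) :=
  {ℓ | ∀ a, ‖ℓ a‖ ≤ R₁}

/-- The loss estimator `f_p(x, a, ℓ) = ⟨r_ℓ(a), p(x)⟩` induced by a predictor `p`. -/
def lossEstimator {X A H : Type*} [NormedAddCommGroup H] [InnerProductSpace ℝ H] (p : X → H) :
    X → A → (A → H) → ℝ :=
  fun x a ℓ => ⟪ℓ a, p x⟫

/-- The quantal response with parameter `β` to the (estimated) losses `v`. -/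
def quantalResponse {A : Type*} [Fintype A] (β : ℝ) (v : A → ℝ) (a : A) : ℝ :=
  Real.exp (-β * v a) / ∑ a', Real.exp (-β * v a')

/-- The smooth optimal decision rule `k̃_{f,ℓ}`. -/
def smoothRule {X A H : Type*} [Fintype A] (β : ℝ) (f : X → A → (A → H) → ℝ) (ℓ : A → H) :
    X → A → ℝ :=
  fun x a => quantalResponse β (fun a' => f x a' ℓ) a

/-- The class of all smooth optimal decision rules induced by the losses in `L`. -/
def smoothRuleClass {X A H : Type*} [Fintype A] (β : ℝ) (f : X → A → (A → H) → ℝ)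
    (L : Set (A → H)) : Set (X → A → ℝ) :=
  {k | ∃ ℓ ∈ L, k = smoothRule β f ℓ}

/-- The decision calibration error of the loss estimator `f` with respect to the class `L` of
losses, the class `𝒦` of decision rules, and the distribution `D`: the supremum over `ℓ ∈ L`,
`k ∈ 𝒦` of `|E_{(x,y)∼D} E_{a∼k(x)} ℓ(a,y) - E_{(x,y)∼D} E_{a∼k(x)} f(x,a,ℓ)|`. -/
def decisionCalibrationError {X Y A H : Type*} [MeasurableSpace X] [MeasurableSpace Y] [Fintype A]
    [NormedAddCommGroup H] [InnerProductSpace ℝ H] [RKHS ℝ H Y ℝ]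
    (D : Measure (X × Y)) (L : Set (A → H)) (𝒦 : Set (X → A → ℝ))
    (f : X → A → (A → H) → ℝ) : ℝ :=
  sSup {t | ∃ ℓ ∈ L, ∃ k ∈ 𝒦,
    t = |(∫ z, ∑ a, k z.1 a * (ℓ a) z.2 ∂D) - ∫ z, ∑ a, k z.1 a * f z.1 a ℓ ∂D|}

/-- The gap `∑ₐ ⟨r_ℓ(a), φ(y) - h⟩ · k̃_{ℓ'}(a)`, where `h = p(x)` is the value of the predictor
and `k̃_{ℓ'}` is the quantal response to the estimated losses `⟨r_{ℓ'}(a), h⟩`. -/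
def gap {Y A H : Type*} [Fintype A] [NormedAddCommGroup H] [InnerProductSpace ℝ H]
    [CompleteSpace H] [RKHS ℝ H Y ℝ] (β : ℝ) (ℓ ℓ' : A → H) (h : H) (y : Y) : ℝ :=
  ∑ a, ⟪ℓ a, feature H y - h⟫ * quantalResponse β (fun a' => ⟪ℓ' a', h⟫) a

/-- The empirical mean of the gap over data `(p(x₁), y₁), …, (p(xₙ), yₙ)`. -/
def empiricalGap {Y A H : Type*} [Fintype A] [NormedAddCommGroup H] [InnerProductSpace ℝ H]
    [CompleteSpace H] [RKHS ℝ H Y ℝ] (β : ℝ) {n : ℕ} (s : Fin n → H × Y) (ℓ ℓ' : A → H) : ℝ :=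
  (1 / (n : ℝ)) * ∑ i, gap β ℓ ℓ' (s i).1 (s i).2

/-- Empirical risk minimization: the set of its admissible outputs on the data `s`, that is, of all
pairs of losses in the class that maximize the empirical gap. -/
def erm {Y A H : Type*} [Fintype A] [NormedAddCommGroup H] [InnerProductSpace ℝ H]
    [CompleteSpace H] [RKHS ℝ H Y ℝ] (β R₁ : ℝ) {n : ℕ} (s : Fin n → H × Y) :
    Set ((A → H) × (A → H)) :=
  {q | q ∈ lossClass A H R₁ ×ˢ lossClass A H R₁ ∧
    ∀ q' ∈ lossClass A H R₁ ×ˢ lossClass A H R₁,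
      empiricalGap β s q'.1 q'.2 ≤ empiricalGap β s q.1 q.2}

/-- `alg`, which maps data `(p(x₁), y₁), …, (p(xₙ), yₙ)` to the set of its admissible outputs, is
an `ε`-auditor with confidence `1 - δ` for the predictor `p` and the distribution `D`: if the
decision calibration error is at least `ε`, then with probability at least `1 - δ` over an i.i.d.
sample, `alg` has an output, and every output is a pair of losses in the class that witnesses an
error of at least `ε / 2` under `D`. The (outer) measure of the failure event is bounded, so
that the success event contains a measurable event of probability at least `1 - δ`. -/
def IsAuditor {X Y A H : Type*} [MeasurableSpace X] [MeasurableSpace Y] [Fintype A]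
    [NormedAddCommGroup H] [InnerProductSpace ℝ H] [CompleteSpace H] [RKHS ℝ H Y ℝ]
    (D : Measure (X × Y)) (p : X → H) (β R₁ ε δ : ℝ) (n : ℕ)
    (alg : (Fin n → H × Y) → Set ((A → H) × (A → H))) : Prop :=
  ε ≤ decisionCalibrationError D (lossClass A H R₁)
      (smoothRuleClass β (lossEstimator p) (lossClass A H R₁)) (lossEstimator p) →
    Measure.pi (fun _ : Fin n => D)
      {s | ¬ ((alg fun i => (p (s i).1, (s i).2)).Nonempty ∧
        ∀ q ∈ alg fun i => (p (s i).1, (s i).2),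
          q.1 ∈ lossClass A H R₁ ∧ q.2 ∈ lossClass A H R₁ ∧
            ε / 2 ≤ |∫ z, gap β q.1 q.2 (p z.1) z.2 ∂D|)} ≤ ENNReal.ofReal δ

/-- The leading factor `|A|² max(1, β R₁ R₂)⁴ R₁² R₂² / ε²` of the sample complexity; it equals
`|A|² β⁴ R₁⁶ R₂⁶ / ε²` as soon as `β R₁ R₂ ≥ 1`. -/
def sampleFactor (m : ℕ) (β R₁ R₂ ε : ℝ) : ℝ :=
  (m : ℝ) ^ 2 * max 1 (β * R₁ * R₂) ^ 4 * R₁ ^ 2 * R₂ ^ 2 / ε ^ 2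

end DecCal

end

open MeasureTheory
open scoped RealInnerProductSpace

noncomputable section

namespace DecCal

/-! ### Finite suprema, random signs and contraction. -/

section FiniteSup

variable {ι : Type*} [Finite ι]

/-! The gap is odd in `ℓ` and the loss class is symmetric, so upper deviations of empirical from
expected gaps are all that has to be controlled. If they are at most `ε / 8` throughout the class,
then a pair with |expected gap| above `3ε / 4`, after a change of sign of `ℓ`, has empirical gap
above `5ε / 8`. Every empirical maximizer does at least as well, so its expected gap is at least `ε
/ 2` (`half_le_abs_integral_gap_of_mem_erm`).

The uniform deviation bound needs no covering numbers. The quantal response is Lipschitz, so the gap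
changes between two pairs of losses by no more than one of `2|A|` linear functionals of the losses
does (`exists_abs_gap_sub_le`). A symmetrized sample point may therefore be replaced by independent
random signs on these functionals (`iSup_contraction`). When all points are replaced, the supremum
is at most a sum of `2|A|` terms, each `R₁` times the norm of a random signed sum in `H`; such norms
grow like `√n`, whatever the dimension of `H` (`integral_iSup_deviation_le`). McDiarmid's inequality
passes from the mean to high probability, and separability of `H` from finite families to the whole
class. -/

lemma le_iSup_finite (f : ι → ℝ) (i : ι) : f i ≤ ⨆ j, f j :=
  le_ciSup (Set.finite_range f).bddAbove i

lemma abs_iSup_sub_iSup_le [Nonempty ι] {f g : ι → ℝ} {c : ℝ} (h : ∀ i, |f i - g i| ≤ c) :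
    |(⨆ i, f i) - ⨆ i, g i| ≤ c := by
  rw [abs_sub_le_iff]
  constructor
  · have : (⨆ i, f i) ≤ (⨆ i, g i) + c := ciSup_le fun i => by
      linarith [(abs_sub_le_iff.1 (h i)).1, le_iSup_finite g i]
    linarith
  · have : (⨆ i, g i) ≤ (⨆ i, f i) + c := ciSup_le fun i => by
      linarith [(abs_sub_le_iff.1 (h i)).2, le_iSup_finite f i]
    linarith

lemma integrable_iSup_finite [Nonempty ι] {Ω : Type*} [MeasurableSpace Ω] {μ : Measure Ω}
    {f : ι → Ω → ℝ} (hm : ∀ i, Measurable (f i)) (hf : ∀ i, Integrable (f i) μ) :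
    Integrable (fun z => ⨆ i, f i z) μ := by
  have := Fintype.ofFinite ι
  refine Integrable.mono' (integrable_finsetSum Finset.univ fun i _ => (hf i).abs)
    (Measurable.iSup hm).aestronglyMeasurable (.of_forall fun z => ?_)
  obtain ⟨i, hi⟩ := exists_eq_ciSup_of_finite (f := fun i => f i z)
  rw [← hi, Real.norm_eq_abs]
  exact Finset.single_le_sum (f := fun i => |f i z|) (fun _ _ => abs_nonneg _) (Finset.mem_univ i)

/-- A contraction inequality for one coordinate: a function that is a contraction with respect to
finitely many coordinates may be replaced by a sum of these coordinates with random signs. -/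
lemma iSup_contraction [Nonempty ι] {κ : Type*} [Fintype κ] [DecidableEq κ]
    (A f : ι → ℝ) (v : ι → κ → ℝ) (h : ∀ s t, ∃ j, |f s - f t| ≤ |v s j - v t j|) :
    ((⨆ t, (A t + f t)) + ⨆ t, (A t - f t)) / 2 ≤
      (∑ σ : κ → ℤˣ, ⨆ t, (A t + ∑ k, ((σ k : ℤ) : ℝ) * v t k)) / Fintype.card (κ → ℤˣ) := by
  obtain ⟨s, hs⟩ := exists_eq_ciSup_of_finite (f := fun t => A t + f t)
  obtain ⟨t, ht⟩ := exists_eq_ciSup_of_finite (f := fun t => A t - f t)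
  obtain ⟨j, hj⟩ := h s t
  rw [← hs, ← ht]
  set N : ℝ := ((Fintype.card (κ → ℤˣ) : ℕ) : ℝ) with hNdef
  have hN : 0 < N := by simp only [N]; exact_mod_cast Fintype.card_pos
  set M : (κ → ℤˣ) → ℝ := fun σ => ⨆ t, (A t + ∑ k, ((σ k : ℤ) : ℝ) * v t k) with hM
  have hMle : ∀ σ u, A u + ∑ k, ((σ k : ℤ) : ℝ) * v u k ≤ M σ := fun σ u =>
    le_iSup_finite (fun t => A t + ∑ k, ((σ k : ℤ) : ℝ) * v t k) u
  set F : κ → ℤˣ := Pi.mulSingle j (-1) with hF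
  have flip : ∀ (σ : κ → ℤˣ) u, ∑ k, (((F * σ) k : ℤ) : ℝ) * v u k =
      (∑ k, ((σ k : ℤ) : ℝ) * v u k) - 2 * ((σ j : ℤ) : ℝ) * v u j := by
    intro σ u
    suffices (∑ k, ((σ k : ℤ) : ℝ) * v u k) - ∑ k, (((F * σ) k : ℤ) : ℝ) * v u k =
      2 * ((σ j : ℤ) : ℝ) * v u j by linarith
    rw [← Finset.sum_sub_distrib, Finset.sum_eq_single j]
    · simp [hF]; ring
    · intro b _ hb; simp [hF, Pi.mulSingle_eq_of_ne hb]
    · simp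
  have neg : ∀ (σ : κ → ℤˣ) u, ∑ k, ((((-1 : κ → ℤˣ) * σ) k : ℤ) : ℝ) * v u k =
      - ∑ k, ((σ k : ℤ) : ℝ) * v u k := by
    intro σ u; simp [Finset.sum_neg_distrib]
  -- `F` flips the sign at `j`. Of the patterns `±σ`, `±F σ`, test `s` on the two whose sign at `j`
  -- agrees with that of `v s j - v t j`, and `t` on the other two. All coordinates except `j`
  -- cancel, and what remains is `2 * |v s j - v t j|`.
  have key : ∀ σ, 2 * (A s + f s + (A t - f t)) ≤
      M σ + M (F * σ) + M (-1 * σ) + M (F * (-1 * σ)) := by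
    intro σ
    have hfj : f s - f t ≤ |v s j - v t j| := (le_abs_self _).trans hj
    have e1 := hMle σ; have e2 := hMle (F * σ)
    have e3 := hMle (-1 * σ); have e4 := hMle (F * (-1 * σ))
    simp only [flip, neg] at e1 e2 e3 e4
    have hn : ((((-1 : κ → ℤˣ) * σ) j : ℤ) : ℝ) = - ((σ j : ℤ) : ℝ) := by simp
    rw [hn] at e4
    have := e1 s; have := e1 t; have := e2 s; have := e2 t
    have := e3 s; have := e3 t; have := e4 s; have := e4 t
    rcases Int.units_eq_one_or (σ j) with h1 | h1 <;> simp only [h1, Units.val_one, Units.val_neg,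
      Int.cast_one, Int.cast_neg] at * <;> rcases abs_cases (v s j - v t j) with h2 | h2 <;>
      linarith
  have hsum := Finset.sum_le_sum fun σ (_ : σ ∈ Finset.univ) => key σ
  -- Multiplication by a fixed pattern permutes the patterns, so the four terms have the same
  -- average.
  have r1 : ∀ (c : κ → ℤˣ) (G : (κ → ℤˣ) → ℝ), ∑ σ, G (c * σ) = ∑ σ, G σ := fun c G =>
    Equiv.sum_comp (Equiv.mulLeft c) G
  simp only [Finset.sum_add_distrib] at hsum
  rw [r1 F M, r1 (-1) M, r1 (-1) fun σ => M (F * σ), r1 F M] at hsum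
  rw [Finset.sum_const, Finset.card_univ, nsmul_eq_mul] at hsum
  rw [le_div_iff₀ hN]
  rw [← hNdef] at hsum
  nlinarith

/-- Averages over random signs of functions of one sign. -/
lemma sum_signs_apply_le {κ : Type*} [Fintype κ] [DecidableEq κ] (k : κ) (G : ℤˣ → ℝ) {b : ℝ}
    (h : (G 1 + G (-1)) / 2 ≤ b) :
    (∑ σ : κ → ℤˣ, G (σ k)) / Fintype.card (κ → ℤˣ) ≤ b := by
  have hN : (0 : ℝ) < Fintype.card (κ → ℤˣ) := by exact_mod_cast Fintype.card_pos
  have e : ∑ σ : κ → ℤˣ, G (-σ k) = ∑ σ : κ → ℤˣ, G (σ k) := by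
    simpa using Equiv.sum_comp (Equiv.mulLeft (-1 : κ → ℤˣ)) fun σ => G (σ k)
  have : ∑ σ : κ → ℤˣ, (G (σ k) + G (-σ k)) ≤ ∑ σ : κ → ℤˣ, 2 * b :=
    Finset.sum_le_sum fun σ _ => by
      rcases Int.units_eq_one_or (σ k) with h1 | h1 <;> simp only [h1, neg_neg] <;> linarith
  rw [Finset.sum_add_distrib, e, Finset.sum_const, Finset.card_univ, nsmul_eq_mul] at this
  rw [div_le_iff₀ hN]
  linarith

end FiniteSup

/-! ### Product measures and McDiarmid's inequality. -/

section Pi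

variable {Ω : Type*} [MeasurableSpace Ω] {μ : Measure Ω} [IsProbabilityMeasure μ]

lemma measurable_finCons {n : ℕ} :
    Measurable fun q : Ω × (Fin n → Ω) => (Fin.cons q.1 q.2 : Fin (n + 1) → Ω) := by
  have := (MeasurableEquiv.piFinSuccAbove (fun _ : Fin (n + 1) => Ω) 0).symm.measurable
  convert this using 2 with q
  simp [MeasurableEquiv.piFinSuccAbove, Fin.insertNthEquiv]

lemma measurePreserving_finCons {n : ℕ} :
    MeasurePreserving (fun q : Ω × (Fin n → Ω) => (Fin.cons q.1 q.2 : Fin (n + 1) → Ω))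
      (μ.prod (Measure.pi fun _ => μ)) (Measure.pi fun _ => μ) := by
  have := (measurePreserving_piFinSuccAbove (fun _ : Fin (n + 1) => μ) 0).symm
  convert this using 2 with q
  simp [MeasurableEquiv.piFinSuccAbove, Fin.insertNthEquiv]

lemma integral_pi_succ {n : ℕ} {F : (Fin (n + 1) → Ω) → ℝ} (hF : Measurable F)
    (hi : Integrable F (Measure.pi fun _ => μ)) :
    ∫ z, F z ∂(Measure.pi fun _ => μ) =
      ∫ a, ∫ z, F (Fin.cons a z) ∂(Measure.pi fun _ => μ) ∂μ := by
  rw [← integral_prod (fun q : Ω × (Fin n → Ω) => F (Fin.cons q.1 q.2))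
    (measurePreserving_finCons.integrable_comp_of_integrable hi),
    ← (measurePreserving_finCons (μ := μ) (n := n)).map_eq,
    integral_map measurable_finCons.aemeasurable hF.aestronglyMeasurable]

/-- The exponential moment bound for functions with bounded differences. -/
lemma integral_exp_le_of_bounded_differences {n : ℕ} {F : (Fin n → Ω) → ℝ} (hF : Measurable F)
    {b c : ℝ} (hb : ∀ z, |F z| ≤ b) (hc : ∀ z i a, |F (Function.update z i a) - F z| ≤ c)
    (l : ℝ) :
    ∫ z, Real.exp (l * F z) ∂(Measure.pi fun _ => μ) ≤
      Real.exp (l * ∫ z, F z ∂(Measure.pi fun _ => μ) + n * (c ^ 2 * l ^ 2 / 2)) := by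
  induction n with
  | zero =>
    have : ∀ z : Fin 0 → Ω, z = default := fun z => Subsingleton.elim _ _
    have h : F = fun _ => F default := by ext z; rw [this z]
    rw [h]; simp
  | succ n ih =>
    have bdd : ∀ (k : ℕ) {f : (Fin k → Ω) → ℝ}, Measurable f → (∀ z, |f z| ≤ b) →
        Integrable f (Measure.pi fun _ => μ) := fun k f hm hf =>
      Integrable.of_bound hm.aestronglyMeasurable b (.of_forall hf)
    have bddexp : ∀ (x : ℝ), |x| ≤ b → |Real.exp (l * x)| ≤ Real.exp (|l| * b) := fun x hx => by
      rw [Real.abs_exp, Real.exp_le_exp]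
      refine (le_abs_self _).trans ?_
      rw [abs_mul]
      exact mul_le_mul_of_nonneg_left hx (abs_nonneg _)
    have hcons : ∀ a, Measurable fun z : Fin n → Ω => F (Fin.cons a z) := fun a =>
      hF.comp (measurable_finCons.comp measurable_prodMk_left)
    -- `G` is the conditional mean given the first coordinate. It inherits oscillation at most `c`,
    -- so Hoeffding's lemma applies to it, while the induction hypothesis handles `F` with that
    -- coordinate frozen.
    set G : Ω → ℝ := fun a => ∫ z, F (Fin.cons a z) ∂(Measure.pi fun _ : Fin n => μ) with hG
    have hGm : Measurable G := by
      have := (hF.comp (measurable_finCons (Ω := Ω) (n := n))).stronglyMeasurable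
      exact (this.integral_prod_right' (ν := Measure.pi fun _ : Fin n => μ)).measurable
    have hGb : ∀ a, |G a| ≤ b := fun a => by
      simpa using norm_integral_le_of_norm_le_const (μ := Measure.pi fun _ : Fin n => μ)
        (f := fun z => F (Fin.cons a z)) (.of_forall fun z => hb (Fin.cons a z))
    have hGc : ∀ a a', |G a - G a'| ≤ c := fun a a' => by
      rw [hG, ← integral_sub (bdd _ (hcons a) fun z => hb _) (bdd _ (hcons a') fun z => hb _)]
      simpa using norm_integral_le_of_norm_le_const (μ := Measure.pi fun _ : Fin n => μ)
        (f := fun z => F (Fin.cons a z) - F (Fin.cons a' z))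
        (.of_forall fun z => by
          simpa [Fin.update_cons_zero] using hc (Fin.cons a' z) 0 a)
    have hGi : Integrable G μ := Integrable.of_bound hGm.aestronglyMeasurable b (.of_forall hGb)
    -- An interval around the mean is easy to exhibit, but its length is `2 * c`; this costs a
    -- factor 4 in the exponent.
    have hGmean : ∀ a, G a ∈ Set.Icc ((∫ x, G x ∂μ) - c) ((∫ x, G x ∂μ) + c) := fun a => by
      have : |∫ x, (G x - G a) ∂μ| ≤ c := by
        simpa using norm_integral_le_of_norm_le_const (μ := μ) (f := fun x => G x - G a)
          (.of_forall fun x => hGc x a)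
      rw [integral_sub hGi (integrable_const _)] at this
      simp only [integral_const, probReal_univ, smul_eq_mul, one_mul] at this
      have := abs_le.1 this
      constructor <;> linarith [this.1, this.2]
    have hoeff := (ProbabilityTheory.hasSubgaussianMGF_of_mem_Icc (μ := μ) hGm.aemeasurable
      (.of_forall hGmean)).mgf_le l
    have hoeff' : ∫ a, Real.exp (l * G a) ∂μ ≤
        Real.exp (l * ∫ x, G x ∂μ + c ^ 2 * l ^ 2 / 2) := by
      have e : ∀ a, Real.exp (l * G a) =
          Real.exp (l * ∫ x, G x ∂μ) * Real.exp (l * (G a - ∫ x, G x ∂μ)) := fun a => by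
        rw [← Real.exp_add]; congr 1; ring
      simp_rw [e]
      rw [integral_const_mul, Real.exp_add]
      refine mul_le_mul_of_nonneg_left (hoeff.trans_eq ?_) (Real.exp_pos _).le
      congr 1
      have : ((‖(∫ x, G x ∂μ) + c - ((∫ x, G x ∂μ) - c)‖₊ : NNReal) : ℝ) ^ 2 = (2 * c) ^ 2 := by
        rw [coe_nnnorm, Real.norm_eq_abs, sq_abs]; ring
      push_cast
      rw [div_pow, ← coe_nnnorm, this]; ring
    have hexpm : Measurable fun z => Real.exp (l * F z) := (hF.const_mul l).exp
    rw [integral_pi_succ hexpm (Integrable.of_bound hexpm.aestronglyMeasurable _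
      (.of_forall fun z => bddexp _ (hb z))), integral_pi_succ hF (bdd _ hF hb)]
    calc ∫ a, ∫ z, Real.exp (l * F (Fin.cons a z)) ∂(Measure.pi fun _ => μ) ∂μ
        ≤ ∫ a, Real.exp (n * (c ^ 2 * l ^ 2 / 2)) * Real.exp (l * G a) ∂μ := by
          refine integral_mono_of_nonneg (.of_forall fun a =>
            integral_nonneg fun z => (Real.exp_pos _).le) ?_ (.of_forall fun a => ?_)
          · exact (Integrable.of_bound (hGm.const_mul l).exp.aestronglyMeasurable _
              (.of_forall fun a => bddexp _ (hGb a))).const_mul _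
          · dsimp only
            rw [← Real.exp_add, add_comm (_ * _ : ℝ) (l * G a)]
            refine ih (hcons a) (fun z => hb _) fun z i a' => ?_
            rw [Fin.cons_update]
            exact hc _ _ _
      _ = Real.exp (n * (c ^ 2 * l ^ 2 / 2)) * ∫ a, Real.exp (l * G a) ∂μ := integral_const_mul _ _
      _ ≤ Real.exp (n * (c ^ 2 * l ^ 2 / 2)) *
          Real.exp (l * ∫ x, G x ∂μ + c ^ 2 * l ^ 2 / 2) :=
          mul_le_mul_of_nonneg_left hoeff' (Real.exp_pos _).le
      _ = _ := by rw [← Real.exp_add]; congr 1; push_cast; ring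

/-- McDiarmid's inequality, with a non-optimal constant. -/
lemma measure_ge_le_of_bounded_differences {n : ℕ} (hn : 0 < n) {F : (Fin n → Ω) → ℝ}
    (hF : Measurable F) {b c : ℝ} (hc0 : 0 < c) (hb : ∀ z, |F z| ≤ b)
    (hc : ∀ z i a, |F (Function.update z i a) - F z| ≤ c) {t : ℝ} (ht : 0 ≤ t) :
    (Measure.pi fun _ => μ) {z | ∫ x, F x ∂(Measure.pi fun _ => μ) + t ≤ F z} ≤
      ENNReal.ofReal (Real.exp (-t ^ 2 / (2 * n * c ^ 2))) := by
  set P : Measure (Fin n → Ω) := Measure.pi fun _ => μ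
  -- The minimizer of `-l * t + n * c ^ 2 * l ^ 2 / 2` in the Chernoff bound.
  set l : ℝ := t / (n * c ^ 2) with hl
  have hn' : (0 : ℝ) < n := by exact_mod_cast hn
  have hl0 : 0 ≤ l := by positivity
  have h := ProbabilityTheory.measure_ge_le_exp_mul_mgf (μ := P) (X := F)
    ((∫ x, F x ∂P) + t) hl0 (by
      refine Integrable.of_bound (hF.const_mul l).exp.aestronglyMeasurable (Real.exp (l * b))
        (.of_forall fun z => ?_)
      rw [Real.norm_eq_abs, Real.abs_exp, Real.exp_le_exp]
      exact mul_le_mul_of_nonneg_left ((le_abs_self _).trans (hb z)) hl0)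
  rw [← ENNReal.ofReal_toReal (measure_ne_top P _)]
  refine ENNReal.ofReal_le_ofReal (h.trans ?_)
  calc _ ≤ Real.exp (-l * ((∫ x, F x ∂P) + t)) *
        Real.exp (l * ∫ z, F z ∂P + n * (c ^ 2 * l ^ 2 / 2)) :=
        mul_le_mul_of_nonneg_left (integral_exp_le_of_bounded_differences hF hb hc l)
          (Real.exp_pos _).le
    _ = _ := by
        rw [← Real.exp_add, hl]; congr 1; field_simp; ring

end Pi

/-! ### Uniform deviations by symmetrization and contraction. -/

section UniformDeviation

variable {ι : Type*} [Finite ι] [Nonempty ι] {Ω : Type*} [MeasurableSpace Ω] {μ : Measure Ω}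
  [IsProbabilityMeasure μ]

/-- Symmetrization of one sample point without a ghost sample: the centered term is the mean of `A t
+ 2 * f t z` and `A t - 2 * ∫ f t`, and the latter is at most the integral of the second supremum.
-/
lemma integral_iSup_centered_le (A : ι → ℝ) {f : ι → Ω → ℝ} (hm : ∀ t, Measurable (f t))
    (hi : ∀ t, Integrable (f t) μ) :
    ∫ z, ⨆ t, (A t + (f t z - ∫ x, f t x ∂μ)) ∂μ ≤
      ∫ z, ((⨆ t, (A t + 2 * f t z)) + ⨆ t, (A t - 2 * f t z)) / 2 ∂μ := by
  have i1 : Integrable (fun z => ⨆ t, (A t + 2 * f t z)) μ :=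
    integrable_iSup_finite (fun t => by fun_prop)
      fun t => (integrable_const _).add ((hi t).const_mul 2)
  have i2 : Integrable (fun z => ⨆ t, (A t - 2 * f t z)) μ :=
    integrable_iSup_finite (fun t => by fun_prop)
      fun t => (integrable_const _).sub ((hi t).const_mul 2)
  have i3 : Integrable (fun z => ⨆ t, (A t + (f t z - ∫ x, f t x ∂μ))) μ :=
    integrable_iSup_finite (fun t => by fun_prop)
      fun t => (integrable_const _).add ((hi t).sub (integrable_const _))
  set I := ∫ z, ⨆ t, (A t - 2 * f t z) ∂μ
  have hI : ∀ t, A t - 2 * ∫ x, f t x ∂μ ≤ I := fun t => by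
    have : ∫ z, (A t - 2 * f t z) ∂μ ≤ I :=
      integral_mono ((integrable_const _).sub ((hi t).const_mul 2)) i2
        fun z => le_iSup_finite (fun t => A t - 2 * f t z) t
    rwa [integral_sub (integrable_const _) ((hi t).const_mul 2), integral_const_mul,
      integral_const, probReal_univ, one_smul] at this
  calc _ ≤ ∫ z, ((⨆ t, (A t + 2 * f t z)) + I) / 2 ∂μ := by
        refine integral_mono i3 ((i1.add (integrable_const _)).div_const 2) fun z =>
          ciSup_le fun t => ?_
        have := le_iSup_finite (fun t => A t + 2 * f t z) t
        have := hI t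
        dsimp only at *
        linarith
    _ = _ := by
        rw [integral_div, integral_div, integral_add i1 i2, integral_add i1 (integrable_const _),
          integral_const, probReal_univ, one_smul]

variable {κ : Type*} [Fintype κ] {H : Type*} [NormedAddCommGroup H] [InnerProductSpace ℝ H]

/-- Parallelogram law and concavity of the root. The potential `√(‖x‖ ^ 2 + c)` is chosen so that
averaging over one random sign only raises `c`, which closes the induction below. -/
lemma sqrt_norm_add_le (x y : H) {c G : ℝ} (hc : 0 ≤ c) (hy : ‖y‖ ≤ G) :
    (√(‖x + y‖ ^ 2 + c) + √(‖x - y‖ ^ 2 + c)) / 2 ≤ √(‖x‖ ^ 2 + (c + G ^ 2)) := by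
  have hy2 : ‖y‖ ^ 2 ≤ G ^ 2 := pow_le_pow_left₀ (norm_nonneg _) hy 2
  have e := parallelogram_law_with_norm ℝ x y
  apply Real.le_sqrt_of_sq_le
  have h1 := Real.sq_sqrt (show 0 ≤ ‖x + y‖ ^ 2 + c by positivity)
  have h2 := Real.sq_sqrt (show 0 ≤ ‖x - y‖ ^ 2 + c by positivity)
  nlinarith [sq_nonneg (√(‖x + y‖ ^ 2 + c) - √(‖x - y‖ ^ 2 + c))]

/-- Expected uniform deviation of functions that are contractions with respect to linear
functionals in a Hilbert space, in the form that is suitable for induction on the sample size. -/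
lemma integral_iSup_deviation_le_aux {f : ι → Ω → ℝ} (hm : ∀ t, Measurable (f t))
    (hi : ∀ t, Integrable (f t) μ) {w : ι → κ → H} {R G : ℝ} (hw : ∀ t k, ‖w t k‖ ≤ R)
    {g : κ → Ω → H} (hg : ∀ k, StronglyMeasurable (g k)) (hgG : ∀ k z, ‖g k z‖ ≤ G)
    (h : ∀ z s t, ∃ j, |f s z - f t z| ≤ |⟪w s j, g j z⟫ - ⟪w t j, g j z⟫|) (n : ℕ) (S : κ → H) :
    ∫ z, ⨆ t, ((∑ k, ⟪w t k, S k⟫) + ∑ i, (f t (z i) - ∫ x, f t x ∂μ))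
        ∂(Measure.pi fun _ : Fin n => μ) ≤
      ∑ k, R * √(‖S k‖ ^ 2 + n * (2 * G) ^ 2) := by
  classical
  -- `S k` accumulates the signed vectors of the sample points already processed. When none are
  -- left, Cauchy–Schwarz decouples the supremum over `k`.
  induction n generalizing S with
  | zero =>
    simp only [Finset.univ_eq_empty, Finset.sum_empty, add_zero, integral_const, probReal_univ,
      one_smul, Nat.cast_zero, zero_mul]
    refine ciSup_le fun t => Finset.sum_le_sum fun k _ => ?_
    rw [Real.sqrt_sq (norm_nonneg _)]
    exact (real_inner_le_norm _ _).trans (mul_le_mul_of_nonneg_right (hw t k) (norm_nonneg _))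
  | succ n ih =>
    set P : Measure (Fin n → Ω) := Measure.pi fun _ => μ
    set N : ℝ := ((Fintype.card (κ → ℤˣ) : ℕ) : ℝ) with hN
    set fb : ι → Ω → ℝ := fun t a => f t a - ∫ x, f t x ∂μ with hfb
    have fbm : ∀ t, Measurable (fb t) := fun t => (hm t).sub_const _
    have fbi : ∀ t, Integrable (fb t) μ := fun t => (hi t).sub (integrable_const _)
    set A : ι → (Fin n → Ω) → ℝ := fun t z => (∑ k, ⟪w t k, S k⟫) + ∑ i, fb t (z i) with hA
    have Am : ∀ t, Measurable (A t) := fun t => by fun_prop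
    have sumi : ∀ (m : ℕ) t, Integrable (fun z : Fin m → Ω => ∑ i, fb t (z i))
        (Measure.pi fun _ => μ) := fun m t => integrable_finsetSum _ fun i _ =>
      (measurePreserving_eval (fun _ : Fin m => μ) i).integrable_comp_of_integrable (fbi t)
    have Ai : ∀ t, Integrable (A t) P := fun t => (integrable_const _).add (sumi n t)
    -- The factor 2 matches the one produced by symmetrization.
    set v : ι → κ → Ω → ℝ := fun t k a => 2 * ⟪w t k, g k a⟫ with hv
    have vm : ∀ t k, Measurable (v t k) := fun t k =>
      (((innerSL ℝ (w t k)).continuous.comp_stronglyMeasurable (hg k)).measurable).const_mul 2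
    have hwR : ∀ t k, 0 ≤ R := fun t k => (norm_nonneg _).trans (hw t k)
    have vi : ∀ t k, Integrable (v t k) μ := fun t k =>
      Integrable.of_bound (vm t k).aestronglyMeasurable (2 * (R * G)) (.of_forall fun a => by
        rw [hv, norm_mul, Real.norm_two]
        gcongr
        exact (norm_inner_le_norm _ _).trans
          (mul_le_mul (hw t k) (hgG k a) (norm_nonneg _) (hwR t k)))
    set U : (κ → ℤˣ) → Ω × (Fin n → Ω) → ℝ := fun σ q =>
      ⨆ t, (A t q.2 + ∑ k, ((σ k : ℤ) : ℝ) * v t k q.1) with hU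
    have Ui : ∀ σ, Integrable (U σ) (μ.prod P) := fun σ =>
      integrable_iSup_finite (fun t => by fun_prop) fun t => (Ai t).comp_snd μ |>.add
        (integrable_finsetSum _ fun k _ => ((vi t k).comp_fst P).const_mul _)
    have Wi : Integrable (fun q : Ω × (Fin n → Ω) => ⨆ t, (A t q.2 + fb t q.1)) (μ.prod P) :=
      integrable_iSup_finite (fun t => by fun_prop) fun t => (Ai t).comp_snd μ |>.add
        ((fbi t).comp_fst P)
    have Avi : Integrable (fun q => (∑ σ, U σ q) / N) (μ.prod P) :=
      (integrable_finsetSum _ fun σ _ => Ui σ).div_const N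
    rw [integral_pi_succ
      (F := fun z => ⨆ t, ((∑ k, ⟪w t k, S k⟫) + ∑ i, (f t (z i) - ∫ x, f t x ∂μ)))
      (Measurable.iSup fun t => by fun_prop)
      (integrable_iSup_finite (fun t => by fun_prop) fun t => (integrable_const _).add
        (sumi (n + 1) t))]
    calc _ = ∫ a, ∫ z, ⨆ t, (A t z + fb t a) ∂P ∂μ := by
          congr! 6 with a z t
          rw [Fin.sum_univ_succ]
          simp only [Fin.cons_zero, Fin.cons_succ, hA]
          ring
      -- The first point is symmetrized with the others frozen; swapping back afterwards freezes it,
      -- so that its signed vectors can be absorbed into `S`.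
      _ = ∫ z, ∫ a, ⨆ t, (A t z + fb t a) ∂μ ∂P := integral_integral_swap Wi
      _ ≤ ∫ z, ∫ a, (∑ σ, U σ (a, z)) / N ∂μ ∂P := by
          refine integral_mono Wi.integral_prod_right Avi.integral_prod_right fun z => ?_
          refine (integral_iSup_centered_le (μ := μ) (fun t => A t z) hm hi).trans ?_
          have j1 : Integrable (fun a => ⨆ t, (A t z + 2 * f t a)) μ :=
            integrable_iSup_finite (fun t => by fun_prop)
              fun t => (integrable_const _).add ((hi t).const_mul 2)
          have j2 : Integrable (fun a => ⨆ t, (A t z - 2 * f t a)) μ :=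
            integrable_iSup_finite (fun t => by fun_prop)
              fun t => (integrable_const _).sub ((hi t).const_mul 2)
          have j3 : Integrable (fun a => (∑ σ, U σ (a, z)) / N) μ :=
            (integrable_finsetSum _ fun σ _ => integrable_iSup_finite (fun t => by fun_prop)
              fun t => (integrable_const (A t z)).add
                (integrable_finsetSum _ fun k _ => (vi t k).const_mul _)).div_const N
          refine integral_mono ((j1.add j2).div_const 2) j3 fun a => ?_
          refine iSup_contraction (fun t => A t z) (fun t => 2 * f t a) (fun t k => v t k a)
            fun s t => ?_
          obtain ⟨j, hj⟩ := h a s t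
          refine ⟨j, ?_⟩
          rw [hv, ← mul_sub, ← mul_sub, abs_mul, abs_mul]
          exact mul_le_mul_of_nonneg_left hj (abs_nonneg _)
      _ = ∫ a, ∫ z, (∑ σ, U σ (a, z)) / N ∂P ∂μ := (integral_integral_swap Avi).symm
      _ ≤ ∫ a, ∑ k, R * √(‖S k‖ ^ 2 + (n * (2 * G) ^ 2 + (2 * G) ^ 2)) ∂μ := by
          refine integral_mono Avi.integral_prod_left (integrable_const _) fun a => ?_
          have ia : ∀ σ, Integrable (fun z => U σ (a, z)) P := fun σ =>
            integrable_iSup_finite (fun t => by fun_prop) fun t =>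
              (Ai t).add (integrable_const (∑ k, ((σ k : ℤ) : ℝ) * v t k a))
          have hle : ∀ σ, ∫ z, U σ (a, z) ∂P ≤
              ∑ k, R * √(‖S k + ((σ k : ℤ) : ℝ) • (2 : ℝ) • g k a‖ ^ 2 + n * (2 * G) ^ 2) := by
            intro σ
            refine le_trans (le_of_eq ?_) (ih fun k => S k + ((σ k : ℤ) : ℝ) • (2 : ℝ) • g k a)
            congr! 4 with z t
            simp only [hA, hv, inner_add_right, inner_smul_right, Finset.sum_add_distrib]
            ring
          dsimp only
          rw [integral_div, integral_finsetSum _ fun σ _ => ia σ]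
          calc _ ≤ (∑ σ : κ → ℤˣ, ∑ k, R *
                √(‖S k + ((σ k : ℤ) : ℝ) • (2 : ℝ) • g k a‖ ^ 2 + n * (2 * G) ^ 2)) / N := by
                gcongr with σ; exact hle σ
            _ = ∑ k, R * ((∑ σ : κ → ℤˣ,
                √(‖S k + ((σ k : ℤ) : ℝ) • (2 : ℝ) • g k a‖ ^ 2 + n * (2 * G) ^ 2)) / N) := by
                rw [Finset.sum_comm, Finset.sum_div]
                refine Finset.sum_congr rfl fun k _ => ?_
                rw [← Finset.mul_sum, mul_div_assoc]
            _ ≤ _ := by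
                refine Finset.sum_le_sum fun k _ => ?_
                refine mul_le_mul_of_nonneg_left ?_ (hwR (Classical.arbitrary ι) k)
                -- The `k`-th term depends on the pattern only through its sign at `k`.
                refine sum_signs_apply_le k (fun s : ℤˣ =>
                  √(‖S k + ((s : ℤ) : ℝ) • (2 : ℝ) • g k a‖ ^ 2 + n * (2 * G) ^ 2)) ?_
                have hy : ‖(2 : ℝ) • g k a‖ ≤ 2 * G := by
                  rw [norm_smul, Real.norm_two]
                  exact mul_le_mul_of_nonneg_left (hgG k a) zero_le_two
                have := sqrt_norm_add_le (S k) ((2 : ℝ) • g k a)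
                  (show (0 : ℝ) ≤ n * (2 * G) ^ 2 by positivity) hy
                simpa [sub_eq_add_neg] using this
      _ = _ := by
          simp only [integral_const, probReal_univ, one_smul]
          push_cast
          congr! 4
          ring

/-- Expected uniform deviation of functions that are contractions with respect to linear
functionals in a Hilbert space. -/
lemma integral_iSup_deviation_le {f : ι → Ω → ℝ} (hm : ∀ t, Measurable (f t))
    (hi : ∀ t, Integrable (f t) μ) {w : ι → κ → H} {R G : ℝ} (hG : 0 ≤ G)
    (hw : ∀ t k, ‖w t k‖ ≤ R)
    {g : κ → Ω → H} (hg : ∀ k, StronglyMeasurable (g k)) (hgG : ∀ k z, ‖g k z‖ ≤ G)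
    (h : ∀ z s t, ∃ j, |f s z - f t z| ≤ |⟪w s j, g j z⟫ - ⟪w t j, g j z⟫|) (n : ℕ) :
    ∫ z, ⨆ t, ∑ i, (f t (z i) - ∫ x, f t x ∂μ) ∂(Measure.pi fun _ : Fin n => μ) ≤
      Fintype.card κ * (R * (√n * (2 * G))) := by
  have := integral_iSup_deviation_le_aux hm hi hw hg hgG h n 0
  simpa [Real.sqrt_sq (show 0 ≤ 2 * G by positivity)] using this

/-- Uniform deviations of a finite family, with high probability. -/
lemma measure_iSup_deviation_ge_le {f : ι → Ω → ℝ} (hm : ∀ t, Measurable (f t)) {b : ℝ}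
    (hb0 : 0 < b) (hb : ∀ t z, |f t z| ≤ b) {w : ι → κ → H} {R G : ℝ} (hG : 0 ≤ G)
    (hw : ∀ t k, ‖w t k‖ ≤ R)
    {g : κ → Ω → H} (hg : ∀ k, StronglyMeasurable (g k)) (hgG : ∀ k z, ‖g k z‖ ≤ G)
    (h : ∀ z s t, ∃ j, |f s z - f t z| ≤ |⟪w s j, g j z⟫ - ⟪w t j, g j z⟫|) {n : ℕ} (hn : 0 < n)
    {u : ℝ} (hu : 0 ≤ u) (hexp : Fintype.card κ * (R * (√n * (2 * G))) ≤ n * u) :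
    (Measure.pi fun _ : Fin n => μ)
        {z | n * (2 * u) ≤ ⨆ t, ∑ i, (f t (z i) - ∫ x, f t x ∂μ)} ≤
      ENNReal.ofReal (Real.exp (-(n * u ^ 2) / (8 * b ^ 2))) := by
  have hi : ∀ t, Integrable (f t) μ := fun t =>
    Integrable.of_bound (hm t).aestronglyMeasurable b (.of_forall (hb t))
  have hmean : ∀ t, |∫ x, f t x ∂μ| ≤ b := fun t => by
    simpa using norm_integral_le_of_norm_le_const (μ := μ) (f := f t) (.of_forall (hb t))
  set F : (Fin n → Ω) → ℝ := fun z => ⨆ t, ∑ i, (f t (z i) - ∫ x, f t x ∂μ) with hF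
  have hn' : (0 : ℝ) < n := by exact_mod_cast hn
  have hFm : Measurable F := Measurable.iSup fun t => by fun_prop
  have hFb : ∀ z, |F z| ≤ n * (2 * b) := fun z => by
    obtain ⟨t, ht⟩ := exists_eq_ciSup_of_finite
      (f := fun t => ∑ i, (f t (z i) - ∫ x, f t x ∂μ))
    simp only [hF]
    rw [← ht]
    refine (Finset.abs_sum_le_sum_abs _ _).trans ?_
    calc _ ≤ ∑ i : Fin n, 2 * b := Finset.sum_le_sum fun i _ => by
          have := abs_sub (f t (z i)) (∫ x, f t x ∂μ)
          linarith [hb t (z i), hmean t]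
      _ = _ := by simp
  have hFc : ∀ z i a, |F (Function.update z i a) - F z| ≤ 2 * b := fun z i a => by
    refine abs_iSup_sub_iSup_le fun t => ?_
    rw [← Finset.sum_sub_distrib, Finset.sum_eq_single i]
    · rw [Function.update_self, sub_sub_sub_cancel_right]
      have := abs_sub (f t a) (f t (z i))
      linarith [hb t (z i), hb t a]
    · intro j _ hj; simp [hj]
    · simp
  -- Half of the threshold, `n * u`, pays for the mean; the other half is the deviation in
  -- McDiarmid's inequality.
  refine (measure_mono ?_).trans ((measure_ge_le_of_bounded_differences (μ := μ) hn hFm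
    (c := 2 * b) (t := n * u) (by positivity) hFb hFc (by positivity)).trans_eq ?_)
  · intro z hz
    have := integral_iSup_deviation_le hm hi hG hw hg hgG h n
    simp only [Set.mem_ofPred_eq] at hz ⊢
    linarith
  · congr 2; field_simp; ring

end UniformDeviation

/-- Uniform deviations of a family with a separable index space, with high probability. -/
lemma measure_exists_deviation_gt_le {ι Ω κ H : Type*} [MeasurableSpace Ω] {μ : Measure Ω}
    [IsProbabilityMeasure μ] [Fintype κ] [NormedAddCommGroup H] [InnerProductSpace ℝ H]
    [TopologicalSpace ι] [TopologicalSpace.SeparableSpace ι]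
    [FirstCountableTopology ι] [Nonempty ι] {f : ι → Ω → ℝ} (hcont : ∀ z, Continuous fun t => f t z)
    (hm : ∀ t, Measurable (f t)) {b : ℝ}
    (hb0 : 0 < b) (hb : ∀ t z, |f t z| ≤ b) {w : ι → κ → H} {R G : ℝ} (hG : 0 ≤ G)
    (hw : ∀ t k, ‖w t k‖ ≤ R)
    {g : κ → Ω → H} (hg : ∀ k, StronglyMeasurable (g k)) (hgG : ∀ k z, ‖g k z‖ ≤ G)
    (h : ∀ z s t, ∃ j, |f s z - f t z| ≤ |⟪w s j, g j z⟫ - ⟪w t j, g j z⟫|) {n : ℕ} (hn : 0 < n)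
    {u : ℝ} (hu : 0 ≤ u) (hexp : Fintype.card κ * (R * (√n * (2 * G))) ≤ n * u) :
    (Measure.pi fun _ : Fin n => μ)
        {z | ∃ t, n * (2 * u) < ∑ i, (f t (z i) - ∫ x, f t x ∂μ)} ≤
      ENNReal.ofReal (Real.exp (-(n * u ^ 2) / (8 * b ^ 2))) := by
  have hIcont : Continuous fun t => ∫ x, f t x ∂μ :=
    continuous_of_dominated (bound := fun _ => b) (fun t => (hm t).aestronglyMeasurable)
      (fun t => .of_forall (hb t)) (integrable_const _) (.of_forall hcont)
  set e := TopologicalSpace.denseSeq ι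
  -- A strict deviation is an open condition on the index, so it already occurs along a dense
  -- sequence. The events for its initial segments increase and obey a bound free of `N`; `N + 1`
  -- keeps the segments nonempty.
  set E : ℕ → Set (Fin n → Ω) := fun N =>
    {z | n * (2 * u) ≤ ⨆ t : Fin (N + 1), ∑ i, (f (e t) (z i) - ∫ x, f (e t) x ∂μ)} with hE
  have hsub : {z | ∃ t, n * (2 * u) < ∑ i, (f t (z i) - ∫ x, f t x ∂μ)} ⊆ ⋃ N, E N := by
    rintro z ⟨t, ht⟩
    have hopen : IsOpen {t | n * (2 * u) < ∑ i, (f t (z i) - ∫ x, f t x ∂μ)} :=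
      isOpen_lt continuous_const
        (continuous_finsetSum _ fun i _ => (hcont (z i)).sub hIcont)
    obtain ⟨_, hN, N, rfl⟩ := (TopologicalSpace.denseRange_denseSeq ι).inter_open_nonempty _ hopen
      ⟨t, ht⟩
    refine Set.mem_iUnion.2 ⟨N, ?_⟩
    have := le_iSup_finite
      (fun t : Fin (N + 1) => ∑ i, (f (e t) (z i) - ∫ x, f (e t) x ∂μ)) (Fin.last N)
    exact hN.le.trans this
  have hmono : Monotone E := by
    intro N N' hNN z hz
    refine le_trans (Set.mem_ofPred.1 hz) (ciSup_le fun t => ?_)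
    exact le_iSup_finite (fun t : Fin (N' + 1) => ∑ i, (f (e t) (z i) - ∫ x, f (e t) x ∂μ))
      (Fin.castLE (by omega) t)
  refine (measure_mono hsub).trans ?_
  rw [hmono.measure_iUnion]
  exact iSup_le fun N => measure_iSup_deviation_ge_le (f := fun t : Fin (N + 1) => f (e t))
    (w := fun t => w (e t)) (fun t => hm _) hb0 (fun t => hb _) hG (fun t => hw _) hg hgG
    (fun z s t => h z _ _) hn hu hexp

/-! ### Stability of the quantal response. -/

section Quantal

variable {A : Type*} [Fintype A]

lemma quantalResponse_nonneg (β : ℝ) (v : A → ℝ) (a : A) : 0 ≤ quantalResponse β v a :=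
  div_nonneg (Real.exp_pos _).le (Finset.sum_nonneg fun _ _ => (Real.exp_pos _).le)

lemma sum_exp_pos [Nonempty A] (v : A → ℝ) : 0 < ∑ a, Real.exp (v a) :=
  Finset.sum_pos (fun _ _ => Real.exp_pos _) Finset.univ_nonempty

lemma sum_quantalResponse [Nonempty A] (β : ℝ) (v : A → ℝ) : ∑ a, quantalResponse β v a = 1 := by
  simp_rw [quantalResponse]
  rw [← Finset.sum_div, div_self (sum_exp_pos _).ne']

/-- Numerator and denominator each change by a factor of at most `exp (β * m)`. -/
lemma exp_mul_quantalResponse_le {β m : ℝ} (hβ : 0 ≤ β) {v v' : A → ℝ}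
    (h : ∀ a, |v a - v' a| ≤ m) (a : A) :
    Real.exp (-(2 * β * m)) * quantalResponse β v a ≤ quantalResponse β v' a := by
  have : Nonempty A := ⟨a⟩
  have key : ∀ {v v' : A → ℝ}, (∀ a, |v a - v' a| ≤ m) → ∀ a,
      Real.exp (-(β * m)) * Real.exp (-β * v a) ≤ Real.exp (-β * v' a) := by
    intro v v' h a
    rw [← Real.exp_add, Real.exp_le_exp]
    nlinarith [(abs_sub_le_iff.1 (h a)).2]
  have h' : ∀ a, |v' a - v a| ≤ m := fun a => by rw [abs_sub_comm]; exact h a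
  have hs : Real.exp (-(β * m)) * ∑ a, Real.exp (-β * v' a) ≤ ∑ a, Real.exp (-β * v a) := by
    rw [Finset.mul_sum]; exact Finset.sum_le_sum fun a _ => key h' a
  have e : Real.exp (-(2 * β * m)) = Real.exp (-(β * m)) * Real.exp (-(β * m)) := by
    rw [← Real.exp_add]; congr 1; ring
  unfold quantalResponse
  rw [← mul_div_assoc, div_le_div_iff₀ (sum_exp_pos _) (sum_exp_pos _), e]
  calc _ = (Real.exp (-(β * m)) * Real.exp (-β * v a)) *
        (Real.exp (-(β * m)) * ∑ a, Real.exp (-β * v' a)) := by ring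
    _ ≤ _ := mul_le_mul (key h a) hs
        (mul_nonneg (Real.exp_pos _).le (sum_exp_pos _).le) (Real.exp_pos _).le

/-- The quantal response is Lipschitz from the supremum norm to the `ℓ¹` norm. -/
lemma sum_abs_quantalResponse_sub_le [Nonempty A] {β m : ℝ} (hβ : 0 ≤ β) {v v' : A → ℝ}
    (h : ∀ a, |v a - v' a| ≤ m) :
    ∑ a, |quantalResponse β v a - quantalResponse β v' a| ≤ 4 * β * m := by
  have hm : 0 ≤ m := (abs_nonneg _).trans (h (Classical.arbitrary A))
  have h' : ∀ a, |v' a - v a| ≤ m := fun a => by rw [abs_sub_comm]; exact h a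
  calc _ ≤ ∑ a, 2 * β * m * (quantalResponse β v a + quantalResponse β v' a) := by
        refine Finset.sum_le_sum fun a _ => ?_
        -- `1 - x ≤ exp (-x)` turns the multiplicative comparison into an additive one.
        have e := Real.add_one_le_exp (-(2 * β * m))
        have h1 := exp_mul_quantalResponse_le hβ h a
        have h2 := exp_mul_quantalResponse_le hβ h' a
        have p1 := quantalResponse_nonneg β v a
        have p2 := quantalResponse_nonneg β v' a
        have x0 : 0 ≤ 2 * β * m := by positivity
        rw [abs_sub_le_iff]
        constructor <;> nlinarith [mul_nonneg x0 p1, mul_nonneg x0 p2]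
    _ = _ := by
        rw [← Finset.mul_sum, Finset.sum_add_distrib, sum_quantalResponse, sum_quantalResponse]
        ring

lemma abs_sum_mul_quantalResponse_le [Nonempty A] {β b : ℝ} {u v : A → ℝ} (hu : ∀ a, |u a| ≤ b) :
    |∑ a, u a * quantalResponse β v a| ≤ b := by
  refine (Finset.abs_sum_le_sum_abs _ _).trans ?_
  calc _ ≤ ∑ a, b * quantalResponse β v a := Finset.sum_le_sum fun a _ => by
        rw [abs_mul, abs_of_nonneg (quantalResponse_nonneg β v a)]
        exact mul_le_mul_of_nonneg_right (hu a) (quantalResponse_nonneg β v a)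
    _ = b := by rw [← Finset.mul_sum, sum_quantalResponse, mul_one]

lemma abs_sum_mul_quantalResponse_sub_le [Nonempty A] {β b m m' : ℝ} (hβ : 0 ≤ β)
    {u u' v v' : A → ℝ} (hu : ∀ a, |u' a| ≤ b) (hm : ∀ a, |u a - u' a| ≤ m)
    (hm' : ∀ a, |v a - v' a| ≤ m') :
    |(∑ a, u a * quantalResponse β v a) - ∑ a, u' a * quantalResponse β v' a| ≤
      m + b * (4 * β * m') := by
  have e : (∑ a, u a * quantalResponse β v a) - ∑ a, u' a * quantalResponse β v' a =
      (∑ a, (u a - u' a) * quantalResponse β v a) +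
        ∑ a, u' a * (quantalResponse β v a - quantalResponse β v' a) := by
    rw [← Finset.sum_sub_distrib, ← Finset.sum_add_distrib]
    exact Finset.sum_congr rfl fun a _ => by ring
  have hb : 0 ≤ b := (abs_nonneg _).trans (hu (Classical.arbitrary A))
  rw [e]
  refine (abs_add_le _ _).trans (add_le_add (abs_sum_mul_quantalResponse_le hm) ?_)
  refine (Finset.abs_sum_le_sum_abs _ _).trans ?_
  calc _ ≤ ∑ a, b * |quantalResponse β v a - quantalResponse β v' a| :=
        Finset.sum_le_sum fun a _ => by
          rw [abs_mul]; exact mul_le_mul_of_nonneg_right (hu a) (abs_nonneg _)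
    _ ≤ _ := by
        rw [← Finset.mul_sum]
        exact mul_le_mul_of_nonneg_left (sum_abs_quantalResponse_sub_le hβ hm') hb

end Quantal

/-! ### The gap as a function of the losses, and existence of empirical maximizers. -/

section Gap

variable {Y A H : Type*} [Fintype A] [NormedAddCommGroup H] [InnerProductSpace ℝ H]
  [CompleteSpace H] [RKHS ℝ H Y ℝ]

lemma inner_feature (f : H) (y : Y) : ⟪f, feature H y⟫ = f y := by
  rw [feature, RKHS.inner_kerFun]; simp

lemma abs_inner_sub_le {H : Type*} [NormedAddCommGroup H] [InnerProductSpace ℝ H] {R₁ R₂ : ℝ} {l x y : H} (hl : ‖l‖ ≤ R₁) (hx : ‖x‖ ≤ R₂) (hy : ‖y‖ ≤ R₂) :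
    |⟪l, x - y⟫| ≤ 2 * (R₁ * R₂) := by
  have h1 := abs_real_inner_le_norm l (x - y)
  have h2 : ‖x - y‖ ≤ 2 * R₂ := (norm_sub_le _ _).trans (by linarith)
  have h3 := mul_le_mul hl h2 (norm_nonneg _) ((norm_nonneg _).trans hl)
  linarith

lemma abs_gap_le [Nonempty A] {β R₁ R₂ : ℝ} {ℓ ℓ' : A → H} (hl : ℓ ∈ lossClass A H R₁)
    {h : H} {y : Y} (hy : ‖feature H y‖ ≤ R₂) (hh : ‖h‖ ≤ R₂) :
    |gap β ℓ ℓ' h y| ≤ 2 * (R₁ * R₂) :=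
  abs_sum_mul_quantalResponse_le fun a => abs_inner_sub_le (hl a) hy hh

lemma gap_neg (β : ℝ) (ℓ ℓ' : A → H) (h : H) (y : Y) :
    gap β (-ℓ) ℓ' h y = - gap β ℓ ℓ' h y := by
  simp [gap, inner_neg_left]

lemma neg_mem_lossClass {A H : Type*} [NormedAddCommGroup H] {R₁ : ℝ} {ℓ : A → H} (hl : ℓ ∈ lossClass A H R₁) :
    -ℓ ∈ lossClass A H R₁ := fun a => by
  rw [Pi.neg_apply, norm_neg]; exact hl a

lemma zero_mem_lossClass {A H : Type*} [NormedAddCommGroup H] {R₁ : ℝ} (h : 0 ≤ R₁) :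
    (0 : A → H) ∈ lossClass A H R₁ := fun a => by
  simpa using h

lemma continuous_gap (β : ℝ) (h : H) (y : Y) :
    Continuous fun q : (A → H) × (A → H) => gap β q.1 q.2 h y := by
  rcases isEmpty_or_nonempty A with hA | hA
  · simp only [gap, Finset.univ_eq_empty, Finset.sum_empty]; exact continuous_const
  · unfold gap quantalResponse
    refine continuous_finsetSum _ fun a _ => Continuous.mul (by fun_prop) ?_
    exact Continuous.div (by fun_prop) (by fun_prop) fun q => (sum_exp_pos _).ne'

/-- The gap is a contraction with respect to linear functionals of the losses. -/
lemma exists_abs_gap_sub_le [Nonempty A] {β R₁ R₂ : ℝ} (hβ : 0 ≤ β)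
    (hR₁ : 0 ≤ R₁) (hR₂ : 0 ≤ R₂) {q q' : (A → H) × (A → H)}
    (hq' : q'.1 ∈ lossClass A H R₁) {h : H} {y : Y} (hy : ‖feature H y‖ ≤ R₂) (hh : ‖h‖ ≤ R₂) :
    ∃ j : A ⊕ A, |gap β q.1 q.2 h y - gap β q'.1 q'.2 h y| ≤
      |⟪Sum.elim q.1 q.2 j,
          Sum.elim (fun _ => (2 : ℝ) • (feature H y - h)) (fun _ => (16 * (β * R₁ * R₂)) • h) j⟫ -
        ⟪Sum.elim q'.1 q'.2 j,
          Sum.elim (fun _ => (2 : ℝ) • (feature H y - h))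
            (fun _ => (16 * (β * R₁ * R₂)) • h) j⟫| := by
  obtain ⟨a, ha⟩ := Finite.exists_max fun a =>
    |⟪q.1 a, feature H y - h⟫ - ⟪q'.1 a, feature H y - h⟫|
  obtain ⟨a', ha'⟩ := Finite.exists_max fun a => |⟪q.2 a, h⟫ - ⟪q'.2 a, h⟫|
  have key : |gap β q.1 q.2 h y - gap β q'.1 q'.2 h y| ≤ _ :=
    abs_sum_mul_quantalResponse_sub_le hβ (fun a => abs_inner_sub_le (hq' a) hy hh) ha ha'
  set m := |⟪q.1 a, feature H y - h⟫ - ⟪q'.1 a, feature H y - h⟫|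
  set m' := |⟪q.2 a', h⟫ - ⟪q'.2 a', h⟫| with hm'
  have hc : 0 ≤ 16 * (β * R₁ * R₂) := by positivity
  -- `key` bounds the change by `m + 8 * (β * R₁ * R₂) * m'`; a sum of two terms is at most twice
  -- the larger, whence the weights 2 and 16.
  rcases le_total (16 * (β * R₁ * R₂) * m') (2 * m) with hle | hle
  · refine ⟨Sum.inl a, key.trans ?_⟩
    simp only [Sum.elim_inl, inner_smul_right]
    rw [← mul_sub, abs_mul, abs_two]
    linarith
  · refine ⟨Sum.inr a', key.trans ?_⟩
    simp only [Sum.elim_inr, inner_smul_right]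
    rw [← mul_sub, abs_mul, abs_of_nonneg hc, ← hm']
    linarith

lemma continuous_empiricalGap (β : ℝ) {n : ℕ} (s : Fin n → H × Y) :
    Continuous fun q : (A → H) × (A → H) => empiricalGap β s q.1 q.2 :=
  continuous_const.mul (continuous_finsetSum _ fun _ _ => continuous_gap β _ _)

/-- Empirical risk minimization has an output: by orthogonal projection, only losses in the span
of the data matter, which form a compact set. -/
lemma erm_nonempty (β : ℝ) {R₁ : ℝ} (hR₁ : 0 ≤ R₁) {n : ℕ} (s : Fin n → H × Y) :
    (erm (A := A) β R₁ s).Nonempty := by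
  obtain ⟨V, _, hs1, hs2⟩ : ∃ V : Submodule ℝ H, FiniteDimensional ℝ V ∧
      (∀ i, (s i).1 ∈ V) ∧ ∀ i, feature H (s i).2 ∈ V :=
    ⟨Submodule.span ℝ (Set.range (fun i => (s i).1) ∪ Set.range fun i => feature H (s i).2),
      FiniteDimensional.span_of_finite ℝ ((Set.finite_range _).union (Set.finite_range _)),
      fun i => Submodule.subset_span (Or.inl ⟨i, rfl⟩),
      fun i => Submodule.subset_span (Or.inr ⟨i, rfl⟩)⟩
  set B : Set (A → V) := Set.univ.pi fun _ => Metric.closedBall 0 R₁ with hB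
  have hBc : IsCompact B := isCompact_univ_pi fun _ => isCompact_closedBall _ _
  have hBne : B.Nonempty := ⟨0, fun a _ => by simpa using hR₁⟩
  set emb : (A → V) → A → H := fun ℓ a => (ℓ a : H) with hemb
  have hembc : Continuous emb := by fun_prop
  have hcont : Continuous fun q : (A → V) × (A → V) => empiricalGap β s (emb q.1) (emb q.2) :=
    (continuous_empiricalGap β s).comp
      ((hembc.comp continuous_fst).prodMk (hembc.comp continuous_snd))
  obtain ⟨q, hqB, hq⟩ := (hBc.prod hBc).exists_isMaxOn (hBne.prod hBne) hcont.continuousOn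
  have hmem : ∀ ℓ ∈ B, emb ℓ ∈ lossClass A H R₁ := fun ℓ hℓ a => by
    simpa using hℓ a (Set.mem_univ a)
  set π : (A → H) → A → V := fun ℓ a => V.orthogonalProjectionOnto (ℓ a) with hπ
  have hπB : ∀ ℓ ∈ lossClass A H R₁, π ℓ ∈ B := fun ℓ hℓ a _ => by
    rw [mem_closedBall_zero_iff]
    exact (V.norm_orthogonalProjectionOnto_apply_le (ℓ a)).trans (hℓ a)
  have hinner : ∀ (x : H) {y : H}, y ∈ V → ⟪x, y⟫ = ⟪(V.orthogonalProjectionOnto x : H), y⟫ := by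
    intro x y hy
    have := V.starProjection_inner_eq_zero x y hy
    rwa [inner_sub_left, sub_eq_zero] at this
  have hproj : ∀ ℓ ℓ' : A → H, empiricalGap β s ℓ ℓ' =
      empiricalGap β s (emb (π ℓ)) (emb (π ℓ')) := by
    intro ℓ ℓ'
    have h1 : ∀ i a, ⟪ℓ a, feature H (s i).2 - (s i).1⟫ =
        ⟪emb (π ℓ) a, feature H (s i).2 - (s i).1⟫ := fun i a =>
      hinner _ (V.sub_mem (hs2 i) (hs1 i))
    have h2 : ∀ i, (fun a => ⟪ℓ' a, (s i).1⟫) = fun a => ⟪emb (π ℓ') a, (s i).1⟫ := fun i =>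
      funext fun a => hinner _ (hs1 i)
    refine congrArg (1 / (n : ℝ) * ·) (Finset.sum_congr rfl fun i _ =>
      Finset.sum_congr rfl fun a _ => ?_)
    rw [h1, h2]
  refine ⟨(emb q.1, emb q.2), ⟨hmem _ hqB.1, hmem _ hqB.2⟩, fun q' hq' => ?_⟩
  have := isMaxOn_iff.1 hq (π q'.1, π q'.2) (Set.mk_mem_prod (hπB _ hq'.1) (hπB _ hq'.2))
  exact (hproj q'.1 q'.2).trans_le this

end Gap

/-! ### From the decision calibration error to the auditor. -/

section Auditor

variable {X Y A H : Type*} [MeasurableSpace X] [MeasurableSpace Y] [Fintype A]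
  [NormedAddCommGroup H] [InnerProductSpace ℝ H] [CompleteSpace H] [RKHS ℝ H Y ℝ]

lemma measurable_inner_left {Ω H : Type*} [MeasurableSpace Ω] [NormedAddCommGroup H]
    [InnerProductSpace ℝ H] (l : H) {g : Ω → H} (hg : StronglyMeasurable g) :
    Measurable fun z => ⟪l, g z⟫ :=
  ((innerSL ℝ l).continuous.comp_stronglyMeasurable hg).measurable

lemma measurable_quantalResponse {Ω A : Type*} [MeasurableSpace Ω] [Fintype A] (β : ℝ)
    {v : Ω → A → ℝ} (hv : ∀ a, Measurable fun z => v z a) (a : A) :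
    Measurable fun z => quantalResponse β (v z) a := by
  unfold quantalResponse
  fun_prop

lemma measurable_gap {p : X → H} (hφ : StronglyMeasurable (feature H : Y → H))
    (hp : StronglyMeasurable p) (β : ℝ) (ℓ ℓ' : A → H) :
    Measurable fun z : X × Y => gap β ℓ ℓ' (p z.1) z.2 := by
  have hp' : StronglyMeasurable fun z : X × Y => p z.1 := hp.comp_measurable measurable_fst
  refine Finset.measurable_fun_sum _ fun a _ => Measurable.mul ?_ ?_
  · exact measurable_inner_left _ ((hφ.comp_measurable measurable_snd).sub hp')
  · exact measurable_quantalResponse β (fun a' => measurable_inner_left _ hp') a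

/-- The two terms of the decision calibration error differ by the expected gap. -/
lemma integral_sub_integral_eq_integral_gap [Nonempty A] {D : Measure (X × Y)}
    [IsProbabilityMeasure D] {p : X → H} {β R₁ R₂ : ℝ}
    (hφ : StronglyMeasurable (feature H : Y → H)) (hp : StronglyMeasurable p)
    (hφR : ∀ y : Y, ‖feature H y‖ ≤ R₂) (hpR : ∀ x, ‖p x‖ ≤ R₂)
    {ℓ : A → H} (hl : ℓ ∈ lossClass A H R₁) (ℓ' : A → H) :
    (∫ z, ∑ a, smoothRule β (lossEstimator p) ℓ' z.1 a * (ℓ a) z.2 ∂D) -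
        ∫ z, ∑ a, smoothRule β (lossEstimator p) ℓ' z.1 a * lossEstimator p z.1 a ℓ ∂D =
      ∫ z, gap β ℓ ℓ' (p z.1) z.2 ∂D := by
  have hp' : StronglyMeasurable fun z : X × Y => p z.1 := hp.comp_measurable measurable_fst
  have hφ' : StronglyMeasurable fun z : X × Y => feature H z.2 :=
    hφ.comp_measurable measurable_snd
  have hint : ∀ {g : X × Y → H}, StronglyMeasurable g → (∀ z, ‖g z‖ ≤ R₂) →
      Integrable (fun z => ∑ a, ⟪ℓ a, g z⟫ * smoothRule β (lossEstimator p) ℓ' z.1 a) D := by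
    intro g hg hgR
    refine Integrable.of_bound (Measurable.aestronglyMeasurable ?_) (R₁ * R₂) (.of_forall fun z =>
      abs_sum_mul_quantalResponse_le fun a => (abs_real_inner_le_norm _ _).trans
        (mul_le_mul (hl a) (hgR z) (norm_nonneg _) ((norm_nonneg _).trans (hl a))))
    exact Finset.measurable_fun_sum _ fun a _ => (measurable_inner_left _ hg).mul
      (measurable_quantalResponse β (fun a' => measurable_inner_left _ hp') a)
  have e1 : ∀ z : X × Y, ∑ a, smoothRule β (lossEstimator p) ℓ' z.1 a * (ℓ a) z.2 =
      ∑ a, ⟪ℓ a, feature H z.2⟫ * smoothRule β (lossEstimator p) ℓ' z.1 a := fun z =>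
    Finset.sum_congr rfl fun a _ => by rw [inner_feature, mul_comm]
  have e2 : ∀ z : X × Y, ∑ a, smoothRule β (lossEstimator p) ℓ' z.1 a * lossEstimator p z.1 a ℓ =
      ∑ a, ⟪ℓ a, p z.1⟫ * smoothRule β (lossEstimator p) ℓ' z.1 a := fun z =>
    Finset.sum_congr rfl fun a _ => mul_comm _ _
  simp_rw [e1, e2]
  rw [← integral_sub (hint hφ' fun z => hφR _) (hint hp' fun z => hpR _)]
  refine integral_congr_ae (.of_forall fun z => ?_)
  simp only [gap, ← Finset.sum_sub_distrib, ← sub_mul, ← inner_sub_right]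
  rfl

/-- A large decision calibration error is almost attained by a pair of losses with a large
expected gap. -/
lemma exists_lt_abs_integral_gap {D : Measure (X × Y)}
    [IsProbabilityMeasure D] {p : X → H} {β R₁ R₂ ε ε' : ℝ} (hR₁ : 0 ≤ R₁)
    (hφ : StronglyMeasurable (feature H : Y → H)) (hp : StronglyMeasurable p)
    (hφR : ∀ y : Y, ‖feature H y‖ ≤ R₂) (hpR : ∀ x, ‖p x‖ ≤ R₂)
    (h : ε ≤ decisionCalibrationError D (lossClass A H R₁)
      (smoothRuleClass β (lossEstimator p) (lossClass A H R₁)) (lossEstimator p))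
    (hε' : 0 ≤ ε') (hεε' : ε' < ε) :
    Nonempty A ∧ ∃ ℓ ∈ lossClass A H R₁, ∃ ℓ' ∈ lossClass A H R₁,
      ε' < |∫ z, gap β ℓ ℓ' (p z.1) z.2 ∂D| := by
  have hlt := hεε'.trans_le h
  rw [decisionCalibrationError] at hlt
  obtain ⟨_, ⟨ℓ, hl, _, ⟨ℓ', hl', rfl⟩, rfl⟩, hlt⟩ := exists_lt_of_lt_csSup
    (by exact ⟨_, 0, zero_mem_lossClass hR₁, _, ⟨0, zero_mem_lossClass hR₁, rfl⟩, rfl⟩) hlt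
  -- Without actions both integrands are empty sums and the error is zero.
  have hA : Nonempty A := by
    by_contra hA
    rw [not_nonempty_iff] at hA
    simp only [Finset.univ_eq_empty, Finset.sum_empty, sub_self, abs_zero] at hlt
    exact absurd hlt hε'.not_gt
  rw [integral_sub_integral_eq_integral_gap hφ hp hφR hpR hl] at hlt
  exact ⟨hA, ℓ, hl, ℓ', hl', hlt⟩

/-- The empirical gaps exceed the expected gaps by at most `ε / 8`, uniformly in the losses and
with high probability. -/
lemma measure_exists_gap_deviation_le [Nonempty A] [TopologicalSpace.SeparableSpace H]
    {D : Measure (X × Y)} [IsProbabilityMeasure D] {p : X → H} {β R₁ R₂ ε : ℝ}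
    (hβ : 0 ≤ β) (hR₁ : 0 < R₁) (hR₂ : 0 < R₂) (hε : 0 ≤ ε)
    (hφ : StronglyMeasurable (feature H : Y → H)) (hp : StronglyMeasurable p)
    (hφR : ∀ y : Y, ‖feature H y‖ ≤ R₂) (hpR : ∀ x, ‖p x‖ ≤ R₂) {n : ℕ} (hn : 0 < n)
    (hexp : 1024 * Fintype.card A * max 1 (β * R₁ * R₂) * R₁ * R₂ ≤ √n * ε) :
    (Measure.pi fun _ : Fin n => D)
        {s | ∃ q ∈ lossClass A H R₁ ×ˢ lossClass A H R₁, (∫ z, gap β q.1 q.2 (p z.1) z.2 ∂D) + ε / 8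
          < empiricalGap β (fun i => (p (s i).1, (s i).2)) q.1 q.2} ≤
      ENNReal.ofReal (Real.exp (-(n * ε ^ 2) / (8192 * (R₁ * R₂) ^ 2))) := by
  have : SecondCountableTopology H := UniformSpace.secondCountable_of_separable H
  set B := max 1 (β * R₁ * R₂) with hB
  have hB1 : 1 ≤ B := le_max_left _ _
  have hB2 : β * R₁ * R₂ ≤ B := le_max_right _ _
  have hn' : (0 : ℝ) < n := by exact_mod_cast hn
  have : Nonempty (lossClass A H R₁ ×ˢ lossClass A H R₁ : Set ((A → H) × (A → H))) :=
    ⟨⟨(0, 0), zero_mem_lossClass hR₁.le, zero_mem_lossClass hR₁.le⟩⟩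
  have hp' : StronglyMeasurable fun z : X × Y => p z.1 := hp.comp_measurable measurable_fst
  have hφ' : StronglyMeasurable fun z : X × Y => feature H z.2 :=
    hφ.comp_measurable measurable_snd
  -- `G` dominates both kinds of functionals: `2 * ‖φ(y) - p(x)‖ ≤ 4 * R₂` and `16 * (β * R₁ * R₂) *
  -- ‖p(x)‖ ≤ 16 * B * R₂`. With `2|A|` functionals the mean is at most `64 * |A| * B * R₁ * R₂ *
  -- √n`, and requiring this to be at most `n * ε / 16` gives the constant 1024.
  have hdev := measure_exists_deviation_gt_le (μ := D)
    (ι := (lossClass A H R₁ ×ˢ lossClass A H R₁ : Set ((A → H) × (A → H))))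
    (f := fun q z => gap β q.1.1 q.1.2 (p z.1) z.2) (b := 2 * (R₁ * R₂)) (R := R₁)
    (G := 16 * B * R₂) (n := n) (u := ε / 16) (κ := A ⊕ A)
    (w := fun q => Sum.elim q.1.1 q.1.2)
    (g := fun j z => Sum.elim (fun _ => (2 : ℝ) • (feature H z.2 - p z.1))
            (fun _ => (16 * (β * R₁ * R₂)) • p z.1) j)
    (fun z => (continuous_gap β _ _).comp continuous_subtype_val)
    (fun q => measurable_gap hφ hp β _ _) (by positivity)
    (fun q z => abs_gap_le q.2.1 (hφR _) (hpR _)) (by positivity)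
    (by
      rintro q (a | a)
      · exact q.2.1 a
      · exact q.2.2 a)
    (by
      rintro (a | a)
      · exact (hφ'.sub hp').const_smul (2 : ℝ)
      · exact hp'.const_smul (16 * (β * R₁ * R₂)))
    (by
      rintro (a | a) z
      · simp only [Sum.elim_inl]
        rw [norm_smul, Real.norm_two]
        have := norm_sub_le (feature H z.2) (p z.1)
        nlinarith [hφR z.2, hpR z.1]
      · simp only [Sum.elim_inr]
        have h0 : 0 ≤ 16 * (β * R₁ * R₂) := by positivity
        rw [norm_smul, Real.norm_of_nonneg h0]
        exact mul_le_mul (by linarith) (hpR z.1) (norm_nonneg _) (by linarith))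
    (fun z q q' => exists_abs_gap_sub_le hβ hR₁.le hR₂.le q'.2.1 (hφR _) (hpR _)) hn
    (by positivity)
    (by
      rw [Fintype.card_sum]
      have := mul_le_mul_of_nonneg_left hexp (Real.sqrt_nonneg n)
      have hs := Real.mul_self_sqrt hn'.le
      rw [← mul_assoc (√(n : ℝ)) (√(n : ℝ)) ε, hs] at this
      push_cast
      linarith)
  refine (measure_mono ?_).trans (hdev.trans_eq ?_)
  · rintro s ⟨q, hq, hlt⟩
    refine ⟨⟨q, hq⟩, ?_⟩
    rw [Finset.sum_sub_distrib, Finset.sum_const, Finset.card_univ, Fintype.card_fin, nsmul_eq_mul]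
    have := mul_lt_mul_of_pos_left hlt hn'
    rw [empiricalGap, ← mul_assoc, mul_one_div_cancel hn'.ne', one_mul] at this
    dsimp only at this ⊢
    linarith
  · congr 2; field_simp; ring

/-- If the empirical gaps do not exceed the expected gaps by more than `ε / 8`, then empirical
risk minimization finds losses with a large expected gap. -/
lemma half_le_abs_integral_gap_of_mem_erm {D : Measure (X × Y)} {p : X → H} {β R₁ ε : ℝ} {n : ℕ}
    {s : Fin n → X × Y} (hs : ∀ q ∈ lossClass A H R₁ ×ˢ lossClass A H R₁,
      empiricalGap β (fun i => (p (s i).1, (s i).2)) q.1 q.2 ≤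
        (∫ z, gap β q.1 q.2 (p z.1) z.2 ∂D) + ε / 8)
    {ℓ ℓ' : A → H} (hl : ℓ ∈ lossClass A H R₁) (hl' : ℓ' ∈ lossClass A H R₁)
    (h : 3 * ε / 4 < |∫ z, gap β ℓ ℓ' (p z.1) z.2 ∂D|) {q : (A → H) × (A → H)}
    (hq : q ∈ erm β R₁ fun i => (p (s i).1, (s i).2)) :
    ε / 2 ≤ |∫ z, gap β q.1 q.2 (p z.1) z.2 ∂D| := by
  have hneg : ∀ ℓ : A → H, empiricalGap β (fun i => (p (s i).1, (s i).2)) (-ℓ) ℓ' =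
      - empiricalGap β (fun i => (p (s i).1, (s i).2)) ℓ ℓ' := fun ℓ => by
    simp only [empiricalGap, gap_neg, Finset.sum_neg_distrib, mul_neg]
  have hneg' : ∫ z, gap β (-ℓ) ℓ' (p z.1) z.2 ∂D = - ∫ z, gap β ℓ ℓ' (p z.1) z.2 ∂D := by
    simp only [gap_neg, integral_neg]
  -- The upper bound at `-ℓ` is the lower bound at `ℓ`.
  have h1 := hs (ℓ, ℓ') ⟨hl, hl'⟩
  have h2 := hs (-ℓ, ℓ') ⟨neg_mem_lossClass hl, hl'⟩
  have h3 := hq.2 (ℓ, ℓ') ⟨hl, hl'⟩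
  have h4 := hq.2 (-ℓ, ℓ') ⟨neg_mem_lossClass hl, hl'⟩
  have h5 := hs q hq.1
  simp only [hneg, hneg'] at h1 h2 h3 h4
  refine le_trans ?_ (le_abs_self _)
  rcases lt_abs.1 h with h6 | h6 <;> linarith

end Auditor

/-- With `t = e + M / δ ≥ 2`, the lower bound on `M` gives `1 / δ ≤ 8 * t ≤ t ^ 4`. -/
lemma neg_log_le_log_exp_add_div {M δ : ℝ} (hM : 9 / 64 ≤ M) (hδ : 0 < δ) :
    -Real.log δ ≤ 4 * Real.log (Real.exp 1 + M / δ) := by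
  have he : (2 : ℝ) ≤ Real.exp 1 := by linarith [Real.add_one_le_exp (1 : ℝ)]
  have hMδ : 0 < M / δ := by positivity
  rw [← Real.log_inv, ← Real.log_rpow (by positivity)]
  refine Real.log_le_log (by positivity) ?_
  rw [show (4 : ℝ) = ((4 : ℕ) : ℝ) by norm_num, Real.rpow_natCast]
  set t := Real.exp 1 + M / δ with ht
  have ht2 : 2 ≤ t := by linarith
  have h1 : δ⁻¹ ≤ 8 * t := by
    have : 9 / 64 * δ⁻¹ ≤ M / δ := by
      rw [div_eq_mul_inv M]; exact mul_le_mul_of_nonneg_right hM (by positivity)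
    linarith [Real.exp_pos 1]
  have h2 : (2 : ℝ) ^ 3 ≤ t ^ 3 := pow_le_pow_left₀ zero_le_two ht2 3
  calc δ⁻¹ ≤ 2 ^ 3 * t := by linarith
    _ ≤ t ^ 3 * t := mul_le_mul_of_nonneg_right h2 (by linarith)
    _ = t ^ 4 := by ring

end DecCal

end

theorem mainTheorem3 :
    ∃ C : ℝ, 0 < C ∧ ∃ q : ℕ,
      ∀ (d : ℕ) (Y : Set (EuclideanSpace ℝ (Fin d))), IsCompact Y → Convex ℝ Y →
      ∀ (X : Type*) [MeasurableSpace X]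
        (A : Type*) [Fintype A]
        (H : Type*) [NormedAddCommGroup H] [InnerProductSpace ℝ H] [CompleteSpace H]
        [TopologicalSpace.SeparableSpace H] [RKHS ℝ H Y ℝ]
        (D : Measure (X × Y)) [IsProbabilityMeasure D]
        (p : X → H) (β R₁ R₂ ε δ : ℝ),
        StronglyMeasurable (DecCal.feature H : Y → H) →
        StronglyMeasurable p →
        0 < β → 0 ≤ R₁ → 0 ≤ R₂ → 0 < ε → 0 < δ → δ < 1 →
        (∀ y : Y, ‖DecCal.feature H y‖ ≤ R₂) →
        (∀ x : X, ‖p x‖ ≤ R₂) →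
        ∀ n : ℕ,
          C * DecCal.sampleFactor (Fintype.card A) β R₁ R₂ ε *
              Real.log (Real.exp 1 + DecCal.sampleFactor (Fintype.card A) β R₁ R₂ ε / δ) ^ q
            ≤ (n : ℝ) →
          DecCal.IsAuditor (A := A) D p β R₁ ε δ n (DecCal.erm β R₁) := by
  refine ⟨2 ^ 20, by norm_num, 1, ?_⟩
  intro d Y _ _ X _ A _ H _ _ _ _ _ D _ p β R₁ R₂ ε δ hφ hp hβ hR₁ hR₂ hε hδ _ hφR hpR n hn hcal
  obtain ⟨hA, ℓ, hl, ℓ', hl', hgap⟩ := DecCal.exists_lt_abs_integral_gap (ε' := 3 * ε / 4)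
    hR₁ hφ hp hφR hpR hcal (by positivity) (by linarith)
  -- An error of size `ε` cannot exceed the range of the gap. This excludes the degenerate cases `R₁
  -- = 0` and `R₂ = 0` and yields `9 / 64 = (3 / 8) ^ 2 ≤ M`.
  have hεR : 3 * ε / 4 < 2 * (R₁ * R₂) := hgap.trans_le <| by
    simpa using norm_integral_le_of_norm_le_const (μ := D)
      (f := fun z => DecCal.gap β ℓ ℓ' (p z.1) z.2)
      (.of_forall fun z => DecCal.abs_gap_le hl (hφR z.2) (hpR z.1))
  have hR : 0 < R₁ * R₂ := by linarith
  have hR₁' : 0 < R₁ := pos_of_mul_pos_left hR hR₂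
  have hR₂' : 0 < R₂ := pos_of_mul_pos_right hR hR₁
  rw [pow_one, mul_assoc] at hn
  set m : ℝ := ((Fintype.card A : ℕ) : ℝ) with hm
  set B := max 1 (β * R₁ * R₂) with hB
  set M := DecCal.sampleFactor (Fintype.card A) β R₁ R₂ ε with hM
  have hm1 : 1 ≤ m := by rw [hm]; exact_mod_cast Fintype.card_pos
  have hB1 : 1 ≤ B := le_max_left _ _
  -- Only the second power of `B` is needed; the fourth power in `M` leaves room.
  have hMB : (m * B * R₁ * R₂ / ε) ^ 2 ≤ M := by
    have : B ^ 2 ≤ B ^ 4 := pow_le_pow_right₀ hB1 (by norm_num)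
    calc _ = m ^ 2 * B ^ 2 * R₁ ^ 2 * R₂ ^ 2 / ε ^ 2 := by ring
      _ ≤ m ^ 2 * B ^ 4 * R₁ ^ 2 * R₂ ^ 2 / ε ^ 2 := by gcongr
  have hMR : (R₁ * R₂ / ε) ^ 2 ≤ M := by
    refine le_trans (pow_le_pow_left₀ (by positivity) ?_ 2) hMB
    gcongr
    have : 1 ≤ m * B := one_le_mul_of_one_le_of_one_le hm1 hB1
    nlinarith
  have hM0 : 9 / 64 ≤ M := by
    have : 3 / 8 ≤ R₁ * R₂ / ε := by rw [le_div_iff₀ hε]; linarith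
    nlinarith
  have hlog := DecCal.neg_log_le_log_exp_add_div hM0 hδ
  set Λ := Real.log (Real.exp 1 + M / δ) with hΛ
  have hΛ1 : 1 ≤ Λ := by
    rw [hΛ, Real.le_log_iff_exp_le (by positivity)]
    have : 0 ≤ M / δ := by positivity
    linarith
  have hMΛ : M ≤ M * Λ := le_mul_of_one_le_right (by linarith) hΛ1
  have hn0 : 0 < n := by
    have : (0 : ℝ) < n := by linarith
    exact_mod_cast this
  -- This fixes `C = 2 ^ 20 = 1024 ^ 2`; the confidence requirement below needs only `4 * 8192 = 2 ^
  -- 15`.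
  have hsqrt : 1024 * m * B * R₁ * R₂ ≤ √n * ε := by
    rw [← div_le_iff₀ hε]
    apply Real.le_sqrt_of_sq_le
    calc _ = 2 ^ 20 * (m * B * R₁ * R₂ / ε) ^ 2 := by ring
      _ ≤ n := by linarith
  have hδexp : Real.exp (-(n * ε ^ 2) / (8192 * (R₁ * R₂) ^ 2)) ≤ δ := by
    rw [← Real.le_log_iff_exp_le hδ, neg_div, neg_le, le_div_iff₀ (by positivity)]
    have h1 : (R₁ * R₂) ^ 2 ≤ M * ε ^ 2 := by
      rwa [div_pow, div_le_iff₀ (by positivity)] at hMR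
    calc -Real.log δ * (8192 * (R₁ * R₂) ^ 2) ≤ 4 * Λ * (8192 * (M * ε ^ 2)) := by gcongr
      _ = 2 ^ 15 * (M * Λ) * ε ^ 2 := by ring
      _ ≤ n * ε ^ 2 := by
        gcongr
        have : 0 ≤ M * Λ := by linarith
        linarith
  refine (measure_mono fun s hs => ?_).trans
    ((DecCal.measure_exists_gap_deviation_le (D := D) (A := A) hβ.le hR₁' hR₂' hε.le hφ hp hφR hpR
      hn0 hsqrt).trans (ENNReal.ofReal_le_ofReal hδexp))
  by_contra hcon
  refine hs ⟨DecCal.erm_nonempty β hR₁ _, fun q hq => ⟨hq.1.1, hq.1.2,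
    DecCal.half_le_abs_integral_gap_of_mem_erm (fun q' hq' => ?_) hl hl' hgap hq⟩⟩
  by_contra hlt
  exact hcon ⟨q', hq', not_le.1 hlt⟩
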